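/- Let $A$ be an infinite abelian group, written multiplicatively. A restricted $2$-subgroup of $A$ is a subgroup $E_2\le A$ all of whose non-identity elements are involutions that are not squares in $A$, and which is maximal (with respect to inclusion) among the subgroups with this property; every abelian group has one, and if the set consisting of the identity and all involutions of $A$ that are not squares is a subgroup, then this set is the unique restricted $2$-subgroup. A strong complete mapping of $A$ is a bijection $\theta\colon A\to A$ such that both $g\mapsto g^{-1}\theta(g)$ and $g\mapsto g\,\theta(g)$ are bijections of $A$. Theorem. Let $A$ be an infinite abelian group and let $E_2$ be a restricted $2$-subgroup of $A$. Then $A$ has a strong complete mapping, except possibly when $A/E_2$ is finite and has a nontrivial cyclic Sylow $3$-subgroup. -/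

import Mathlib

/-- `θ` is an orthomorphism of `G`: both `θ` and `g ↦ g⁻¹ θ(g)` are bijections of `G`. -/
def IsOrthomorphism {G : Type*} [Group G] (θ : G → G) : Prop :=
  Function.Bijective θ ∧ Function.Bijective (fun g => g⁻¹ * θ g)

/-- `θ` is a complete mapping of `G`: both `θ` and `g ↦ g θ(g)` are bijections of `G`. -/
def IsCompleteMapping {G : Type*} [Group G] (θ : G → G) : Prop :=
  Function.Bijective θ ∧ Function.Bijective (fun g => g * θ g)

/-- A strong complete mapping is both an orthomorphism and a complete mapping. -/
def IsStrongCompleteMapping {G : Type*} [Group G] (θ : G → G) : Prop :=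
  IsOrthomorphism θ ∧ IsCompleteMapping θ

/-- The identity together with the involutions that are not squares. This set need not be closed
under multiplication (in `ℤ/4 × ℤ/2` it is not). -/
def restrictedTwoSet (A : Type*) [CommGroup A] : Set A :=
  {x | x = 1 ∨ (orderOf x = 2 ∧ ¬ IsSquare x)}

/-- `E` is a restricted `2`-subgroup of the abelian group `A`: a subgroup consisting of the
identity and involutions that are not squares in `A`, and maximal among such subgroups. -/
def IsRestrictedTwoSubgroup {A : Type*} [CommGroup A] (E : Subgroup A) : Prop :=
  Maximal (fun H : Subgroup A => (H : Set A) ⊆ restrictedTwoSet A) E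

/-- Every abelian group has a restricted `2`-subgroup. -/
theorem exists_isRestrictedTwoSubgroup (A : Type*) [CommGroup A] :
    ∃ E : Subgroup A, IsRestrictedTwoSubgroup E := by
  refine zorn_le₀ {H : Subgroup A | (H : Set A) ⊆ restrictedTwoSet A} ?_
  intro c hc hchain
  rcases c.eq_empty_or_nonempty with rfl | hne
  · refine ⟨⊥, ?_, by simp⟩
    intro x hx
    exact Or.inl (by simpa using hx)
  · refine ⟨sSup c, ?_, fun z hz => le_sSup hz⟩
    intro x hx
    obtain ⟨H, hH, hxH⟩ := (Subgroup.mem_sSup_of_directedOn hne hchain.directedOn).1 hx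
    exact hc hH hxH

/-- If the identity together with the involutions that are not squares is a subgroup, then this is
the only restricted `2`-subgroup. -/
theorem isRestrictedTwoSubgroup_iff_of_coe_eq {A : Type*} [CommGroup A] {E₂ : Subgroup A}
    (h : (E₂ : Set A) = restrictedTwoSet A) (E : Subgroup A) :
    IsRestrictedTwoSubgroup E ↔ E = E₂ := by
  constructor
  · intro hE
    have hle : E ≤ E₂ := by
      intro x hx
      have hx' : x ∈ (E₂ : Set A) := h ▸ hE.prop hx
      exact hx'
    exact le_antisymm hle (hE.le_of_ge h.le hle)
  · rintro rfl
    refine ⟨h.le, ?_⟩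
    intro H hH _ x hx
    have hx' : x ∈ (E : Set A) := h ▸ hH hx
    exact hx'

/-!
A strong complete mapping of `G` is the same as a set of pairs `(g, h)` on which each of the four
maps `g`, `h`, `g * h`, `g⁻¹ * h` is a bijection onto `G`. Such a set is built greedily along a
well-order of length `#G`: at each stage one more value of one of the four maps has to be attained,
while fewer than `#G` values of each map have been used up.

Prescribing `g` or `h` leaves the other one free. Prescribing `g * h = y` forces
`g⁻¹ * h = (g * g)⁻¹ * y`, so here the freedom is measured by the number of squares. If there are
`#G` squares, pairs can therefore be added one at a time. If there are fewer, then products and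
quotients compete for the same few elements of a coset of the subgroup of squares, and the coset is
filled in one stroke by the pairs `(e x * g, e x * h * x)`, where `x` runs over the squares and the
`e x` are elements with `e x * e x = 1` in different cosets: their products are `g * h * x` and
their quotients are `g⁻¹ * h * x`. There are enough such elements, since the kernel of squaring has
`#G` elements when the image has fewer.
-/

section Development

open Cardinal Set Function

universe u

theorem mk_iUnion_lt_of_finite {ι : Type*} [Finite ι] {α : Type u} {s : ι → Set α}
    {κ : Cardinal.{u}} (hκ : ℵ₀ ≤ κ) (hs : ∀ i, #(s i) < κ) : #(⋃ i, s i) < κ := by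
  rcases isEmpty_or_nonempty ι
  · simpa using aleph0_pos.trans_le hκ
  · obtain ⟨i, hi⟩ := exists_eq_ciSup_of_finite (f := fun i => lift #(s i))
    refine lift_lt.1 ((mk_iUnion_le_lift s).trans_lt (mul_lt_of_lt (aleph0_le_lift.2 hκ) ?_ ?_))
    · exact (lift_lt_aleph0.2 (lt_aleph0_of_finite ι)).trans_le (aleph0_le_lift.2 hκ)
    · exact hi ▸ lift_lt.2 (hs i)

theorem injective_update_of_notMem_range {α β : Type*} [DecidableEq α] {f : α → β}
    (hf : Injective f) {a : α} {b : β} (hb : b ∉ range f) : Injective (update f a b) := by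
  intro x y hxy
  grind [update_apply]

theorem eq_of_mul_eq_of_lt {a b c : Cardinal.{u}} (hc : ℵ₀ ≤ c) (h : a * b = c) (ha : a < c) :
    b = c := by
  have hb : b ≤ c := h ▸ le_mul_left (by rintro rfl; exact ha.ne ((zero_mul b).symm.trans h))
  exact hb.eq_of_not_lt fun hbc => (mul_lt_of_lt hc ha hbc).ne h

theorem exists_forall_notMem_of_injective {ι : Type*} [Finite ι] {W : Type u} [Infinite W]
    {Y : ι → Type u} {f : ∀ i, W → Y i} (hf : ∀ i, Injective (f i)) {Z : ∀ i, Set (Y i)}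
    (hZ : ∀ i, #(Z i) < #W) : ∃ w, ∀ i, f i w ∉ Z i := by
  by_contra! hcon
  have hcover : ⋃ i, f i ⁻¹' Z i = Set.univ := eq_univ_of_forall fun w => mem_iUnion.2 (hcon w)
  have hlt : #(⋃ i, f i ⁻¹' Z i) < #W := mk_iUnion_lt_of_finite (aleph0_le_mk W) fun i =>
    (mk_preimage_of_injective _ _ (hf i)).trans_lt (hZ i)
  rw [hcover, mk_univ] at hlt
  exact hlt.false

theorem exists_wellOrder_forall_image_Iio {X T : Type u} {P : T → Set X → X → Prop}
    (h : ∀ (t : T) (S : Set X), #S < #T → ∃ x, P t S x) :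
    ∃ (_ : LinearOrder T) (_ : WellFoundedLT T) (x : T → X), ∀ t, P t (x '' Iio t) (x t) := by
  obtain ⟨_, _, hord⟩ := exists_ord_eq_type_lt T
  choose pick pick_spec using h
  have range_lt (t : T) (x : Iio t → X) : #(range x) < #T :=
    mk_range_le.trans_lt (mk_Iio_lt t hord)
  let x : T → X := wellFounded_lt.fix fun t x => pick t (range fun s : Iio t => x s s.2)
    (range_lt t _)
  have x_eq (t : T) : x t = pick t (range fun s : Iio t => x s) (range_lt t _) :=
    WellFounded.fix_eq _ _ _
  refine ⟨inferInstance, inferInstance, x, fun t => ?_⟩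
  rw [image_eq_range, x_eq]
  exact pick_spec t _ (range_lt t _)

theorem exists_pairwiseDisjoint_biUnion_eq_univ {X T : Type u} {f : X → Set T}
    (h : ∀ (t : T) (S : Set X), #S < #T → t ∉ ⋃ x ∈ S, f x →
      ∃ x, t ∈ f x ∧ Disjoint (f x) (⋃ x ∈ S, f x)) :
    ∃ S : Set X, S.PairwiseDisjoint f ∧ ⋃ x ∈ S, f x = Set.univ := by
  have hstep (t : T) (S : Set X) (hS : #S < #T) :
      ∃ x, t ∈ f x ∧ (x ∈ S ∨ Disjoint (f x) (⋃ x ∈ S, f x)) := by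
    by_cases ht : t ∈ ⋃ x ∈ S, f x
    · obtain ⟨x, hxS, hx⟩ := mem_iUnion₂.1 ht
      exact ⟨x, hx, Or.inl hxS⟩
    · obtain ⟨x, hx, hdisj⟩ := h t S hS ht
      exact ⟨x, hx, Or.inr hdisj⟩
  obtain ⟨_, _, x, hx⟩ := exists_wellOrder_forall_image_Iio hstep
  have eq_or_disjoint (t : T) : ∀ s < t, x s = x t ∨ Disjoint (f (x s)) (f (x t)) := by
    induction t using WellFoundedLT.induction with
    | ind t ih =>
      intro s hst
      rcases (hx t).2 with ⟨r, hrt, hr⟩ | hdisj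
      · rw [← hr]
        rcases lt_trichotomy s r with hsr | rfl | hrs
        · exact ih r hrt s hsr
        · exact Or.inl rfl
        · exact (ih s hst r hrs).imp Eq.symm fun hd => hd.symm
      · exact Or.inr (disjoint_iUnion₂_right.1 hdisj (x s) (mem_image_of_mem x hst)).symm
  refine ⟨range x, ?_, eq_univ_of_forall fun t => mem_biUnion (mem_range_self t) (hx t).1⟩
  rintro _ ⟨s, rfl⟩ _ ⟨t, rfl⟩ hne
  rcases lt_trichotomy s t with hst | rfl | hts
  · exact (eq_or_disjoint t s hst).resolve_left hne
  · exact absurd rfl hne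
  · exact ((eq_or_disjoint s t hts).resolve_left hne.symm).symm

section Group

variable {G : Type u} [Group G]

/-- The four values `g`, `h`, `g * h`, `g⁻¹ * h` attached to a pair `(g, h)`. A strong complete
mapping is a set of pairs on which each of them is a bijection onto the group. -/
def scmEntry : Fin 4 → G × G → G :=
  ![Prod.fst, Prod.snd, fun p => p.1 * p.2, fun p => p.1⁻¹ * p.2]

theorem exists_isStrongCompleteMapping_of_bijOn {S : Set (G × G)}
    (hS : ∀ i, BijOn (scmEntry i) S Set.univ) : ∃ θ : G → G, IsStrongCompleteMapping θ := by
  have hex (g : G) : ∃ h, (g, h) ∈ S := by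
    obtain ⟨⟨a, h⟩, hp, rfl⟩ := (hS 0).surjOn (mem_univ g)
    exact ⟨h, hp⟩
  choose θ hθ using hex
  have hgraph : BijOn (fun g => (g, θ g)) Set.univ S :=
    ⟨fun g _ => hθ g, fun _ _ _ _ h => congrArg Prod.fst h,
      fun p hp => ⟨p.1, mem_univ _, (hS 0).injOn (hθ p.1) hp rfl⟩⟩
  have hbij (i : Fin 4) : Bijective fun g => scmEntry i (g, θ g) :=
    bijOn_univ.1 ((hS i).comp hgraph)
  exact ⟨θ, ⟨hbij 1, hbij 3⟩, hbij 1, hbij 2⟩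

theorem exists_isStrongCompleteMapping_of_blocks [Infinite G] {X : Type u} {B : X → Set (G × G)}
    {μ : Cardinal.{u}} (hμ : μ < #G) (hB : ∀ x, #(B x) ≤ μ)
    (hinj : ∀ x i, InjOn (scmEntry i) (B x))
    (hext : ∀ i y (C : Set X), #(⋃ x ∈ C, B x) < #G → y ∉ scmEntry i '' ⋃ x ∈ C, B x →
      ∃ x, y ∈ scmEntry i '' B x ∧
        ∀ j, Disjoint (scmEntry j '' B x) (scmEntry j '' ⋃ x ∈ C, B x)) :
    ∃ θ : G → G, IsStrongCompleteMapping θ := by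
  have hT : #(Fin 4 × G) = #G := by
    simp [mul_eq_right (aleph0_le_mk G) ((ofNat_lt_aleph0 (n := 4)).le.trans (aleph0_le_mk G))]
  let F (S : Set (G × G)) : Set (Fin 4 × G) := {t | t.2 ∈ scmEntry t.1 '' S}
  have F_biUnion (C : Set X) : ⋃ x ∈ C, F (B x) = F (⋃ x ∈ C, B x) := by
    ext t
    simp only [F, image_iUnion₂, mem_iUnion, mem_ofPred_eq]
  obtain ⟨C, hdisj, hcover⟩ :
      ∃ C : Set X, C.PairwiseDisjoint (fun x => F (B x)) ∧ ⋃ x ∈ C, F (B x) = Set.univ := by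
    refine exists_pairwiseDisjoint_biUnion_eq_univ fun t C hC ht => ?_
    have hcard : #(⋃ x ∈ C, B x) < #G :=
      (mk_biUnion_le _ _).trans_lt (mul_lt_of_lt (aleph0_le_mk G) (hT ▸ hC)
        ((ciSup_le' fun x : C => hB x).trans_lt hμ))
    rw [F_biUnion] at ht ⊢
    obtain ⟨x, hx, hxC⟩ := hext t.1 t.2 C hcard ht
    exact ⟨x, hx, disjoint_left.2 fun s hs => disjoint_left.1 (hxC s.1) hs⟩
  refine exists_isStrongCompleteMapping_of_bijOn (S := ⋃ x ∈ C, B x) fun i =>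
    ⟨mapsTo_univ _ _, fun p hp q hq hpq => ?_, fun y _ => ?_⟩
  · obtain ⟨a, ha, hpa⟩ := mem_iUnion₂.1 hp
    obtain ⟨b, hb, hqb⟩ := mem_iUnion₂.1 hq
    obtain rfl : a = b :=
      hdisj.elim_set ha hb (i, scmEntry i p) ⟨p, hpa, rfl⟩ ⟨q, hqb, hpq.symm⟩
    exact hinj a i hpa hqb hpq
  · exact (F_biUnion C ▸ hcover ▸ mem_univ (i, y) : (i, y) ∈ F (⋃ x ∈ C, B x))

/-- A parametrisation by `g` of the pairs `p` with `scmEntry i p = y`. -/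
def scmFiber (i : Fin 4) (y g : G) : G × G :=
  (![(y, g), (g, y), (g, g⁻¹ * y), (g, g * y)] : Fin 4 → G × G) i

theorem scmEntry_scmFiber (i : Fin 4) (y g : G) : scmEntry i (scmFiber i y g) = y := by
  fin_cases i <;> simp [scmEntry, scmFiber]

theorem injective_scmEntry_scmFiber {i j : Fin 4} (hij : i ≠ j) (h : i < 2 ∨ j < 2) (y : G) :
    Injective fun g => scmEntry j (scmFiber i y g) := by
  intro a b
  fin_cases i <;> fin_cases j <;> simp_all [scmEntry, scmFiber]

theorem injective_scmEntry_scmFiber_of_injective_mul_self {W : Type*} {s : W → G}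
    (hs : Injective fun w => s w * s w) {i j : Fin 4} (hij : i ≠ j) (y : G) :
    Injective fun w => scmEntry j (scmFiber i y (s w)) := by
  rcases em (i < 2 ∨ j < 2) with h | h
  · exact (injective_scmEntry_scmFiber hij h y).comp (hs.of_comp (f := fun g => g * g))
  · have h' : (i = 2 ∧ j = 3) ∨ (i = 3 ∧ j = 2) := by omega
    rcases h' with ⟨rfl, rfl⟩ | ⟨rfl, rfl⟩
    · have hval (w : W) : scmEntry 3 (scmFiber 2 y (s w)) = (s w * s w)⁻¹ * y := by
        simp [scmEntry, scmFiber, mul_assoc]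
      simp only [hval]
      exact (mul_left_injective y).comp (inv_injective.comp hs)
    · have hval (w : W) : scmEntry 2 (scmFiber 3 y (s w)) = s w * s w * y := by
        simp [scmEntry, scmFiber, mul_assoc]
      simp only [hval]
      exact (mul_left_injective y).comp hs

theorem exists_isStrongCompleteMapping_of_mk_isSquare_eq [Infinite G]
    (hG : #{x : G | IsSquare x} = #G) : ∃ θ : G → G, IsStrongCompleteMapping θ := by
  have : Infinite {x : G | IsSquare x} := infinite_iff.2 (hG ▸ aleph0_le_mk G)
  choose s hs using fun x : {x : G | IsSquare x} => x.2
  have hs_inj : Injective fun x => s x * s x := fun x y h =>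
    Subtype.ext ((hs x).trans (h.trans (hs y).symm))
  refine exists_isStrongCompleteMapping_of_blocks (B := fun p : G × G => {p})
    (one_lt_aleph0.trans_le (aleph0_le_mk G)) (by simp) (fun p i => injOn_singleton _ p)
    fun i y C hC hy => ?_
  obtain ⟨x, hx⟩ := exists_forall_notMem_of_injective (ι := {j // i ≠ j})
    (fun j => injective_scmEntry_scmFiber_of_injective_mul_self hs_inj j.2 y)
    (Z := fun j => scmEntry j.1 '' ⋃ p ∈ C, {p}) fun j => (mk_image_le.trans_lt hC).trans_eq hG.symm
  refine ⟨scmFiber i y (s x), by simp [scmEntry_scmFiber], fun j => ?_⟩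
  rw [image_singleton, disjoint_singleton_left]
  obtain rfl | hij := eq_or_ne i j
  · rwa [scmEntry_scmFiber]
  · exact hx ⟨j, hij⟩

theorem mk_quotient_mul_mk_subgroup (H : Subgroup G) : #(G ⧸ H) * #H = #G :=
  (mul_def _ _).trans (mk_congr H.groupEquivQuotientProdSubgroup).symm

theorem mk_range_mul_mk_ker {N : Type u} [Group N] (f : G →* N) : #f.range * #f.ker = #G := by
  rw [← mk_congr (QuotientGroup.quotientKerEquivRange f).toEquiv, mk_quotient_mul_mk_subgroup]

theorem map_scmEntry {N : Type*} [Group N] (f : G →* N) (i : Fin 4) (p : G × G) :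
    f (scmEntry i p) = scmEntry i (Prod.map f f p) := by
  fin_cases i <;> simp [scmEntry]

theorem map_scmFiber {N : Type*} [Group N] (f : G →* N) (i : Fin 4) (y g : G) :
    Prod.map f f (scmFiber i y g) = scmFiber i (f y) (f g) := by
  fin_cases i <;> simp [scmFiber]

end Group

section CommGroup

open Subgroup

variable {G : Type u} [CommGroup G]

theorem mk_scmEntry {i : Fin 4} (hi : 2 ≤ i) (p : G × G) :
    ((scmEntry i p : G) : G ⧸ square G) = (p.1 * p.2 : G) := by
  obtain rfl | rfl : i = 2 ∨ i = 3 := by omega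
  · rfl
  · exact QuotientGroup.eq.2 (mem_square.2 ⟨p.1, by simp [scmEntry, mul_comm, mul_assoc]⟩)

/-- `S` is saturated if its products `g * h`, and likewise its quotients `g⁻¹ * h`, form a union of
cosets of the subgroup of squares. Both kinds of values of a pair lie in the same coset, so it
suffices to speak about the coset of the product. -/
def IsSquareSaturated (S : Set (G × G)) : Prop :=
  ∀ p ∈ S, ∀ z : G, (z : G ⧸ square G) = (p.1 * p.2 : G) → ∀ i, 2 ≤ i → z ∈ scmEntry i '' S

theorem IsSquareSaturated.biUnion {X : Type*} {B : X → Set (G × G)} {C : Set X}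
    (hB : ∀ x ∈ C, IsSquareSaturated (B x)) : IsSquareSaturated (⋃ x ∈ C, B x) := by
  intro p hp z hz i hi
  obtain ⟨x, hx, hpx⟩ := mem_iUnion₂.1 hp
  exact image_mono (subset_biUnion_of_mem hx) (hB x hx p hpx z hz i hi)

theorem IsSquareSaturated.mem_image {S : Set (G × G)} (hS : IsSquareSaturated S) {i j : Fin 4}
    (hi : 2 ≤ i) (hj : 2 ≤ j) {p : G × G} (hp : p ∈ S) {z : G}
    (hz : (z : G ⧸ square G) = (scmEntry i p : G)) : z ∈ scmEntry j '' S :=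
  hS p hp z (hz.trans (mk_scmEntry hi p)) j hj

/-- The pairs `(e x * p.1, e x * p.2 * x)`, for `x` a square. If all `e x` square to `1`, then the
products and the quotients of these pairs fill the coset of squares to which those of `p` belong. -/
def squareBlock (e : square G → G) (p : G × G) (x : square G) : G × G :=
  (e x * p.1, e x * p.2 * x)

theorem squareBlock_one {e : square G → G} (he : e 1 = 1) (p : G × G) : squareBlock e p 1 = p := by
  simp [squareBlock, he]

theorem scmEntry_squareBlock {e : square G → G} (he : ∀ x, e x * e x = 1) {i : Fin 4} (hi : 2 ≤ i)
    (p : G × G) (x : square G) : scmEntry i (squareBlock e p x) = scmEntry i p * x := by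
  obtain rfl | rfl : i = 2 ∨ i = 3 := by omega
  · calc e x * p.1 * (e x * p.2 * x) = e x * e x * (p.1 * p.2 * x) := by ac_rfl
      _ = p.1 * p.2 * x := by rw [he, one_mul]
  · calc (e x * p.1)⁻¹ * (e x * p.2 * x) = (e x)⁻¹ * e x * (p.1⁻¹ * p.2 * x) := by
          rw [mul_inv]; ac_rfl
      _ = p.1⁻¹ * p.2 * x := by rw [inv_mul_cancel, one_mul]

theorem mk_scmEntry_squareBlock (e : square G → G) {i : Fin 4} (hi : i < 2) (p : G × G)
    (x : square G) :
    ((scmEntry i (squareBlock e p x) : G) : G ⧸ square G) = e x * (scmEntry i p : G) := by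
  obtain rfl | rfl : i = 0 ∨ i = 1 := by omega
  · rfl
  · exact QuotientGroup.mk_mul_of_mem _ x.2

theorem injective_scmEntry_squareBlock {e : square G → G} (he : ∀ x, e x * e x = 1)
    (he_inj : Injective fun x => (e x : G ⧸ square G)) (i : Fin 4) (p : G × G) :
    Injective fun x => scmEntry i (squareBlock e p x) := by
  rcases lt_or_ge i 2 with hi | hi
  · refine Injective.of_comp (f := ((↑) : G → G ⧸ square G)) ?_
    simp only [comp_def, mk_scmEntry_squareBlock e hi]
    exact (mul_left_injective _).comp he_inj
  · simp only [scmEntry_squareBlock he hi]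
    exact (mul_right_injective _).comp Subtype.val_injective

theorem isSquareSaturated_range_squareBlock {e : square G → G} (he : ∀ x, e x * e x = 1)
    (p : G × G) : IsSquareSaturated (range (squareBlock e p)) := by
  rintro _ ⟨x, rfl⟩ z hz i hi
  have hmem : (scmEntry i p)⁻¹ * z ∈ square G := by
    rw [← QuotientGroup.eq, hz, ← mk_scmEntry hi, scmEntry_squareBlock he hi]
    exact (QuotientGroup.mk_mul_of_mem _ x.2).symm
  exact ⟨_, mem_range_self ⟨_, hmem⟩, by rw [scmEntry_squareBlock he hi, mul_inv_cancel_left]⟩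

theorem mk_ker_powMonoidHom_two_eq [Infinite G] (hG : #(square G) < #G) :
    #(powMonoidHom 2 : G →* G).ker = #G := by
  have hrange : (powMonoidHom 2 : G →* G).range = square G := by
    ext x
    simp [isSquare_iff_exists_sq, eq_comm]
  exact eq_of_mul_eq_of_lt (aleph0_le_mk G) (mk_range_mul_mk_ker _) (hrange ▸ hG)

theorem mk_range_mk_comp_ker_powMonoidHom_two_eq [Infinite G] (hG : #(square G) < #G) :
    #((QuotientGroup.mk' (square G)).comp (powMonoidHom 2 : G →* G).ker.subtype).range = #G := by
  set φ := (QuotientGroup.mk' (square G)).comp (powMonoidHom 2 : G →* G).ker.subtype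
  have hker : #φ.ker ≤ #(square G) :=
    mk_le_of_injective (f := fun k => ⟨k.1, (QuotientGroup.eq_one_iff _).1 k.2⟩) fun k l h =>
      Subtype.ext (Subtype.ext (Subtype.mk.inj h))
  have hmul : #φ.ker * #φ.range = #G := by
    rw [mul_comm, mk_range_mul_mk_ker, mk_ker_powMonoidHom_two_eq hG]
  exact eq_of_mul_eq_of_lt (aleph0_le_mk G) hmul (hker.trans_lt hG)

theorem exists_mul_self_eq_one_and_injective_mk [Infinite G] (hG : #(square G) < #G)
    {Z : Set (G ⧸ square G)} (hZ : #Z < #G) :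
    ∃ e : square G → G, (∀ x, e x * e x = 1) ∧ (Injective fun x => (e x : G ⧸ square G)) ∧
      ∀ x, (e x : G ⧸ square G) ∉ Z := by
  let φ := (QuotientGroup.mk' (square G)).comp (powMonoidHom 2 : G →* G).ker.subtype
  have hφ : #φ.range = #G := mk_range_mk_comp_ker_powMonoidHom_two_eq hG
  have : Infinite φ.range := infinite_iff.2 (hφ ▸ aleph0_le_mk G)
  have hlt : #((↑) ⁻¹' Z : Set φ.range) < #φ.range :=
    (mk_preimage_of_injective _ _ Subtype.val_injective).trans_lt (hZ.trans_eq hφ.symm)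
  have havoid : #((↑) ⁻¹' Zᶜ : Set φ.range) = #G := (mk_compl_of_infinite _ hlt).trans hφ
  obtain ⟨w⟩ : Nonempty (square G ↪ ((↑) ⁻¹' Zᶜ : Set φ.range)) :=
    (le_def _ _).1 (hG.le.trans_eq havoid.symm)
  choose k hk using fun x => (w x).1.2
  refine ⟨fun x => k x, fun x => ?_, fun x y hxy => ?_, fun x => ?_⟩
  · exact (pow_two _).symm.trans (MonoidHom.mem_ker.1 (k x).2)
  · exact w.injective (Subtype.ext (Subtype.ext ((hk x).symm.trans (hxy.trans (hk y)))))
  · exact fun h => (w x).2 (hk x ▸ h)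

theorem exists_mul_self_eq_one_and_injective_mk_of_map_one [Infinite G] (hG : #(square G) < #G)
    {Z : Set (G ⧸ square G)} (hZ : #Z < #G) :
    ∃ e : square G → G, e 1 = 1 ∧ (∀ x, e x * e x = 1) ∧
      (Injective fun x => (e x : G ⧸ square G)) ∧ ∀ x ≠ 1, (e x : G ⧸ square G) ∉ Z := by
  classical
  obtain ⟨e, he, he_inj, heZ⟩ := exists_mul_self_eq_one_and_injective_mk hG (Z := insert 1 Z)
    (mk_insert_le.trans_lt (add_lt_of_lt (aleph0_le_mk G) hZ
      (one_lt_aleph0.trans_le (aleph0_le_mk G))))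
  simp only [mem_insert_iff, not_or] at heZ
  have mk_update : (fun x => (update e 1 1 x : G ⧸ square G)) = update (fun x => ↑(e x)) 1 1 :=
    comp_update _ _ _ _
  refine ⟨update e 1 1, update_self _ _ _, fun x => ?_, ?_, fun x hx => ?_⟩
  · obtain rfl | hx := eq_or_ne x 1
    · rw [update_self, one_mul]
    · rw [update_of_ne hx, he]
  · rw [mk_update]
    exact injective_update_of_notMem_range he_inj fun ⟨x, hx⟩ => (heZ x).1 hx
  · rw [update_of_ne hx]
    exact (heZ x).2

theorem exists_forall_disjoint_scmEntry_squareBlock [Infinite G] (hG : #(square G) < #G)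
    {S : Set (G × G)} (hS : IsSquareSaturated S) (hS_lt : #S < #G) {p : G × G}
    (hp : ∀ i, scmEntry i p ∉ scmEntry i '' S) :
    ∃ e : square G → G, e 1 = 1 ∧ (∀ x, e x * e x = 1) ∧
      (Injective fun x => (e x : G ⧸ square G)) ∧
      ∀ i, Disjoint (scmEntry i '' range (squareBlock e p)) (scmEntry i '' S) := by
  let Z (i : Fin 4) : Set (G ⧸ square G) :=
    (fun q => ((scmEntry i q : G) : G ⧸ square G) / (scmEntry i p : G)) '' S
  obtain ⟨e, he_one, he, he_inj, heZ⟩ :=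
    exists_mul_self_eq_one_and_injective_mk_of_map_one hG (Z := ⋃ i, Z i)
      (mk_iUnion_lt_of_finite (aleph0_le_mk G) fun i => mk_image_le.trans_lt hS_lt)
  refine ⟨e, he_one, he, he_inj, fun i => disjoint_left.2 ?_⟩
  rintro _ ⟨_, ⟨x, rfl⟩, rfl⟩ ⟨q, hq, hqx⟩
  have hmk : ((scmEntry i q : G) : G ⧸ square G) = (scmEntry i (squareBlock e p x) : G) :=
    congrArg _ hqx
  rcases lt_or_ge i 2 with hi | hi
  · rw [mk_scmEntry_squareBlock e hi] at hmk
    obtain rfl | hx := eq_or_ne x 1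
    · exact hp i ⟨q, hq, hqx.trans (congrArg _ (squareBlock_one he_one p))⟩
    · exact heZ x hx (mem_iUnion.2 ⟨i, q, hq, div_eq_iff_eq_mul.2 hmk⟩)
  · rw [scmEntry_squareBlock he hi, QuotientGroup.mk_mul_of_mem _ x.2] at hmk
    exact hp i (hS.mem_image hi hi hq hmk.symm)

theorem exists_scmEntry_eq_forall_notMem [Infinite G] (hG : #(square G) < #G) {S : Set (G × G)}
    (hS : IsSquareSaturated S) (hS_lt : #S < #G) {i : Fin 4} {y : G} (hy : y ∉ scmEntry i '' S) :
    ∃ p, scmEntry i p = y ∧ ∀ j, scmEntry j p ∉ scmEntry j '' S := by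
  let π := QuotientGroup.mk' (square G)
  have hQ : #(G ⧸ square G) = #G :=
    eq_of_mul_eq_of_lt (aleph0_le_mk G)
      ((mul_comm _ _).trans (mk_quotient_mul_mk_subgroup (square G))) hG
  have : Infinite (G ⧸ square G) := infinite_iff.2 (hQ ▸ aleph0_le_mk G)
  obtain ⟨w, hw⟩ := exists_forall_notMem_of_injective (ι := {j // i ≠ j ∧ (i < 2 ∨ j < 2)})
    (fun j => injective_scmEntry_scmFiber j.2.1 j.2.2 (π y))
    (Z := fun j => (fun q => π (scmEntry j.1 q)) '' S)
    fun j => mk_image_le.trans_lt (hS_lt.trans_eq hQ.symm)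
  obtain ⟨g, rfl⟩ := QuotientGroup.mk'_surjective _ w
  refine ⟨scmFiber i y g, scmEntry_scmFiber i y g, fun j => ?_⟩
  rintro ⟨q, hq, hqj⟩
  obtain rfl | hij := eq_or_ne i j
  · exact hy ⟨q, hq, hqj.trans (scmEntry_scmFiber i y g)⟩
  · rcases em (i < 2 ∨ j < 2) with h | h
    · refine hw ⟨j, hij, h⟩ ⟨q, hq, ?_⟩
      simp only [hqj, map_scmEntry, map_scmFiber, π]
    · obtain ⟨hi, hj⟩ : 2 ≤ i ∧ 2 ≤ j := by omega
      refine hy (hS.mem_image hj hi hq ?_)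
      rw [hqj, mk_scmEntry hj, ← mk_scmEntry hi, scmEntry_scmFiber]

theorem exists_isStrongCompleteMapping_of_mk_square_lt [Infinite G] (hG : #(square G) < #G) :
    ∃ θ : G → G, IsStrongCompleteMapping θ := by
  let X := {D : Set (G × G) //
    #D ≤ #(square G) ∧ (∀ i, InjOn (scmEntry i) D) ∧ IsSquareSaturated D}
  refine exists_isStrongCompleteMapping_of_blocks (B := fun D : X => D.1) hG (fun D => D.2.1)
    (fun D => D.2.2.1) fun i y C hC hy => ?_
  have hsat : IsSquareSaturated (⋃ D ∈ C, D.1) := .biUnion fun D _ => D.2.2.2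
  obtain ⟨p, rfl, hp⟩ := exists_scmEntry_eq_forall_notMem hG hsat hC hy
  obtain ⟨e, he_one, he, he_inj, hdisj⟩ := exists_forall_disjoint_scmEntry_squareBlock hG hsat hC hp
  refine ⟨⟨range (squareBlock e p), mk_range_le,
    fun i => (injective_scmEntry_squareBlock he he_inj i p).injOn_range,
    isSquareSaturated_range_squareBlock he p⟩, ⟨p, ⟨1, squareBlock_one he_one p⟩, rfl⟩, hdisj⟩

end CommGroup

end Development

theorem mainTheorem7_general (A : Type*) [CommGroup A] [Infinite A] :
    ∃ θ : A → A, IsStrongCompleteMapping θ := by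
  rcases (Cardinal.mk_set_le (Subgroup.square A : Set A)).lt_or_eq with h | h
  · exact exists_isStrongCompleteMapping_of_mk_square_lt h
  · exact exists_isStrongCompleteMapping_of_mk_isSquare_eq h

theorem mainTheorem7 (A : Type*) [CommGroup A] [Infinite A]
    (E₂ : Subgroup A) (hE₂ : IsRestrictedTwoSubgroup E₂)
    (hA : ¬ (Finite (A ⧸ E₂) ∧ ∃ P : Sylow 3 (A ⧸ E₂), Nontrivial P ∧ IsCyclic P)) :
    ∃ θ : A → A, IsStrongCompleteMapping θ :=
  mainTheorem7_general A
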